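/- **Model.** A constrained-deadline sporadic task is a triple $\tau_i=(T_i,C_i,D_i)$ with integers $T_i\ge 1$, $D_i\ge 0$ and a real $C_i$ such that $0\le C_i\le D_i\le T_i$. It releases jobs at non-negative integer times, any two releases being at least $T_i$ apart; a job released at time $r$ needs at most $C_i$ units of processor time, has absolute deadline $r+D_i$, and never executes on two processors at once. A (feasible) multiprocessor periodic resource (MPR) model $\Gamma=\langle\Pi,\Theta,m'\rangle$ consists of integers $\Pi,m'\ge 1$ and a real $\Theta$ with $0\le\Theta\le m'\Pi$. A processor supply, i.e. a measurable function $s$ giving the number $s(t)$ of unit-capacity processors available at each real time $t\ge 0$, conforms to $\Gamma$ if $s(t)\le m'$ for all $t\ge 0$ and $\int_{j\Pi}^{(j+1)\Pi}s(t)\,dt\ge\Theta$ for every integer $j\ge 0$. Under global EDF (gEDF), with free preemption and migration, at each instant $t$ the $s(t)$ unfinished released jobs with the earliest absolute deadlines execute (all of them if there are at most $s(t)$), ties being broken arbitrarily. Tasks $\tau_1,\dots,\tau_n$ are *schedulable under gEDF using $\Gamma$* if, for every supply conforming to $\Gamma$, every such collection of jobs and every gEDF schedule of these jobs on this supply, each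 job receives the processor time it needs by its deadline. **Supply bound.** Let $\beta=\Theta-m'\lfloor\Theta/m'\rfloor$, $t'=t-(\Pi-\lceil\Theta/m'\rceil)$, $x=t'-\Pi\lfloor t'/\Pi\rfloor$, $y=\Pi-\lfloor\Theta/m'\rfloor$, and $$\mathrm{sbf}_\Gamma(t)=\begin{cases}0 & t'<0,\\ \lfloor t'/\Pi\rfloor\Theta+\max\{0,\,m'x-(m'\Pi-\Theta)\} & t'\ge 0,\ x\in[1,y],\\ \lfloor t'/\Pi\rfloor\Theta+\max\{0,\,m'x-(m'\Pi-\Theta)\}-(m'-\beta) & t'\ge 0,\ x\notin[1,y].\end{cases}$$ **Demand bound.** Let $N_i(t)=\lfloor (t+T_i-D_i)/T_i\rfloor$, $CI_i(t)=\min\{C_i,\max\{0,t-N_i(t)T_i\}\}$ and $W_i(t)=N_i(t)C_i+CI_i(t)$. For a task $\tau_k$ and $A_k\ge 0$ put $t=A_k+D_k$ and $$\bar I_i=\min\{W_i(t),\,t-C_k\},\quad \hat I_i=\min\{W_i(t)-CI_i(t),\,t-C_k\}\quad(i\ne k),$$ $$\bar I_k=\min\{W_k(t)-C_k,\,A_k\},\quad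 \hat I_k=\min\{W_k(t)-C_k-CI_k(t),\,A_k\},$$ $$\mathrm{dem}(A_k+D_k,m')=m'C_k+\sum_{i=1}^n\hat I_i+\sum_{i\in L}(\bar I_i-\hat I_i),$$ where $L$ is a set of indices of the $m'-1$ largest values among $\bar I_1-\hat I_1,\dots,\bar I_n-\hat I_n$ (all indices if $n\le m'-1$). **Theorem.** If $\mathrm{dem}(A_k+D_k,m')\le\mathrm{sbf}_\Gamma(A_k+D_k)$ for every task $\tau_k$ and every integer $A_k\ge 0$, then $\tau_1,\dots,\tau_n$ are schedulable under gEDF using $\Gamma$. -/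

import Mathlib

open MeasureTheory

noncomputable section

namespace ClusterSched

/-- A constrained deadline sporadic task `(T, C, D)`: minimum release separation, maximum
processor requirement of a job, relative deadline. -/
structure SporadicTask where
  T : ℕ
  C : ℝ
  D : ℕ
  T_pos : 0 < T
  C_nonneg : 0 ≤ C
  C_le_D : C ≤ D
  D_le_T : D ≤ T

/-- A feasible multiprocessor periodic resource model `⟨Π, Θ, m'⟩`. -/
structure MPR where
  period : ℕ
  capacity : ℝ
  procs : ℕ
  period_pos : 0 < period
  procs_pos : 0 < procs
  capacity_nonneg : 0 ≤ capacity
  capacity_le : capacity ≤ procs * period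

/-- A processor supply, given by the number `s t` of unit-capacity processors available to the
cluster at each instant `t ≥ 0`, conforms to the resource model: never more than `m'` processors
at an instant, and at least `Θ` units of processor time in each period `[jΠ, (j+1)Π]`. -/
def MPR.IsSupply (Γ : MPR) (s : ℝ → ℕ) : Prop :=
  Measurable s ∧
  (∀ t, 0 ≤ t → s t ≤ Γ.procs) ∧
  ∀ j : ℕ, Γ.capacity ≤ ∫ t in ((j : ℝ) * Γ.period)..(((j : ℝ) + 1) * Γ.period), (s t : ℝ)

open Classical in
/-- The supply bound function of `⟨Π, Θ, m'⟩`, with `α = ⌊Θ/m'⌋`, `β = Θ - m' α`,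
`t' = t - (Π - ⌈Θ/m'⌉)`, `x = t' - Π ⌊t'/Π⌋`, `y = Π - ⌊Θ/m'⌋`. -/
def MPR.sbf (Γ : MPR) (t : ℝ) : ℝ :=
  let P : ℝ := Γ.period
  let Θ : ℝ := Γ.capacity
  let m : ℝ := Γ.procs
  let α : ℝ := ⌊Θ / m⌋
  let β : ℝ := Θ - m * α
  let t' : ℝ := t - (P - ⌈Θ / m⌉)
  let x : ℝ := t' - P * ⌊t' / P⌋
  let y : ℝ := P - ⌊Θ / m⌋
  if t' < 0 then 0
  else if x ∈ Set.Icc 1 y then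
    ⌊t' / P⌋ * Θ + max 0 (m * x - (m * P - Θ))
  else
    ⌊t' / P⌋ * Θ + max 0 (m * x - (m * P - Θ)) - (m - β)

/-- A legal collection of jobs of the task set. The job of task `i` released at time `r` is the
pair `(i, r)`; `cost (i, r)` is the processor time it needs, at most `C i`. -/
structure Jobs {n : ℕ} (τ : Fin n → SporadicTask) where
  release : Fin n → Set ℕ
  cost : Fin n × ℕ → ℝ
  separated : ∀ i, ∀ r ∈ release i, ∀ r' ∈ release i, r < r' → r + (τ i).T ≤ r'
  cost_nonneg : ∀ i, ∀ r ∈ release i, 0 ≤ cost (i, r)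
  cost_le : ∀ i, ∀ r ∈ release i, cost (i, r) ≤ (τ i).C

/-- The absolute deadline of a job. -/
def deadline {n : ℕ} (τ : Fin n → SporadicTask) (j : Fin n × ℕ) : ℕ := j.2 + (τ j.1).D

/-- A schedule gives, for each job, the set of instants at which it executes (on one processor;
identical processors and free migration make the identity of the processor irrelevant). The
service of a job up to time `t` is the total length of its execution in `[0, t]`. -/
def service {n : ℕ} (exec : Fin n × ℕ → Set ℝ) (j : Fin n × ℕ) (t : ℝ) : ℝ :=
  volume.real (exec j ∩ Set.Icc 0 t)

/-- The job is released and unfinished at time `t`. -/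
def Pending {n : ℕ} {τ : Fin n → SporadicTask} (J : Jobs τ) (exec : Fin n × ℕ → Set ℝ)
    (t : ℝ) (j : Fin n × ℕ) : Prop :=
  j.2 ∈ J.release j.1 ∧ (j.2 : ℝ) ≤ t ∧ service exec j t < J.cost j

/-- Preemptive global EDF on the supply `s`: at each instant only unfinished released jobs execute,
at most one processor per job and at most `s t` of them; no available processor is left idle while
some unfinished job waits; and no job executes while one with a strictly earlier absolute
deadline waits. Ties are broken arbitrarily. -/
structure IsGEDF {n : ℕ} {τ : Fin n → SporadicTask} (s : ℝ → ℕ) (J : Jobs τ)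
    (exec : Fin n × ℕ → Set ℝ) : Prop where
  measurable : ∀ j, MeasurableSet (exec j)
  pending : ∀ t, 0 ≤ t → ∀ j, t ∈ exec j → Pending J exec t j
  concurrency : ∀ t, 0 ≤ t → {j | t ∈ exec j}.encard ≤ (s t : ℕ∞)
  work_conserving : ∀ t, 0 ≤ t → (∃ j, Pending J exec t j ∧ t ∉ exec j) →
    {j | t ∈ exec j}.encard = (s t : ℕ∞)
  edf : ∀ t, 0 ≤ t → ∀ j j', t ∈ exec j → Pending J exec t j' → t ∉ exec j' →
    deadline τ j ≤ deadline τ j'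

/-- The task set is schedulable under global EDF using `Γ`: whatever the conforming supply, the
legal jobs, and the global EDF schedule of the jobs on the supply, all deadlines are met. -/
def Schedulable {n : ℕ} (τ : Fin n → SporadicTask) (Γ : MPR) : Prop :=
  ∀ s : ℝ → ℕ, Γ.IsSupply s → ∀ J : Jobs τ, ∀ exec : Fin n × ℕ → Set ℝ, IsGEDF s J exec →
    ∀ i, ∀ r ∈ J.release i, J.cost (i, r) ≤ service exec (i, r) (deadline τ (i, r))

/-- `⌊(t + (T - D)) / T⌋`. -/
def SporadicTask.count (τ : SporadicTask) (t : ℝ) : ℝ :=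
  ⌊(t + ((τ.T : ℝ) - τ.D)) / τ.T⌋

/-- Carry-in demand bound in an interval of length `t`. -/
def SporadicTask.CI (τ : SporadicTask) (t : ℝ) : ℝ :=
  min τ.C (max 0 (t - τ.count t * τ.T))

/-- Workload bound in an interval of length `t`. -/
def SporadicTask.W (τ : SporadicTask) (t : ℝ) : ℝ :=
  τ.count t * τ.C + τ.CI t

/-- The bound `Ī_{i,2}` (with carry-in) for the interval of length `A + D k`. -/
def Ibar {n : ℕ} (τ : Fin n → SporadicTask) (k : Fin n) (A : ℝ) (i : Fin n) : ℝ :=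
  let t : ℝ := A + (τ k).D
  if i = k then min ((τ k).W t - (τ k).C) A
  else min ((τ i).W t) (t - (τ k).C)

/-- The bound `Î_{i,2}` (without carry-in) for the interval of length `A + D k`. -/
def Ihat {n : ℕ} (τ : Fin n → SporadicTask) (k : Fin n) (A : ℝ) (i : Fin n) : ℝ :=
  let t : ℝ := A + (τ k).D
  if i = k then min ((τ k).W t - (τ k).C - (τ k).CI t) A
  else min ((τ i).W t - (τ i).CI t) (t - (τ k).C)

/-- The sum of the `q` largest among `n` values (all of them if `n ≤ q`). -/
def sumLargest {n : ℕ} (q : ℕ) (v : Fin n → ℝ) : ℝ :=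
  (Finset.powersetCard (min q n) (Finset.univ : Finset (Fin n))).sup'
    (Finset.powersetCard_nonempty.2 (by simp)) fun L => ∑ i ∈ L, v i

/-- The demand bound `dem(A + D k, m')`. -/
def dem {n : ℕ} (τ : Fin n → SporadicTask) (m' : ℕ) (k : Fin n) (A : ℝ) : ℝ :=
  m' * (τ k).C + ∑ i, Ihat τ k A i + sumLargest (m' - 1) fun i => Ibar τ k A i - Ihat τ k A i

end ClusterSched

end

namespace ClusterSched

/-! ### The supply bound -/

/-! Consider the earliest missed deadline `d`, missed by the job `(k, r)`. Going back from `r`, take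
the earliest integer `a` such that throughout `[a, r)` every available processor executes work with
deadline at most `d`. If `a > 0`, some processor is not so occupied at an instant of `[a - 1, a]`.
Releases being integers, every job carried into `a` is already pending at that instant and must be
executing, so fewer than `m'` tasks carry in (`IsGEDF.card_carryIn_lt`, `IsGEDF.exists_busy_start`).

Let `t = d - a`, `A = r - a`, and let `e < C_k` be the time for which `(k, r)` executes in `[a, d)`.
Whenever it does not execute, all available processors serve other jobs with deadline at most `d`.
Hence the supply in `[a, d)` is at most `m' e` plus the total interference
(`MPR.IsSupply.integral_le`). The interference of a task is bounded by its workload, with carry-in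
for at most `m' - 1` tasks, and also by `t - e`, or by `A` for task `k` itself. The test uses the
cap `t - C_k` instead of `t - e`, and `supply_lt_or_le_demand` repairs this: either the supply is
strictly below `dem`, or `dem ≥ m' t`. The first contradicts `dem ≤ sbf` because `sbf` is a lower
bound on supply (`MPR.IsSupply.sbf_le_integral`); the second contradicts the strict inequality `sbf
t < m' t`, which is what `MPR.sbf_lt` is for. -/

lemma MPR.sbf_lt (Γ : MPR) {t : ℝ} (ht : 0 < t) : Γ.sbf t < Γ.procs * t := by
  have hP : (0 : ℝ) < Γ.period := by exact_mod_cast Γ.period_pos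
  have hm : (0 : ℝ) < Γ.procs := by exact_mod_cast Γ.procs_pos
  have hΘ := Γ.capacity_nonneg
  have hcap := Γ.capacity_le
  unfold MPR.sbf
  set P : ℝ := (Γ.period : ℝ)
  set Θ : ℝ := Γ.capacity
  set m : ℝ := (Γ.procs : ℝ)
  have hq : Θ / m ≤ P := by rw [div_le_iff₀ hm]; linarith
  have hc : ((⌈Θ / m⌉ : ℤ) : ℝ) ≤ P := by
    have : ⌈Θ / m⌉ ≤ (Γ.period : ℤ) := Int.ceil_le.2 (by exact_mod_cast hq)
    simpa [P] using (Int.cast_le (R := ℝ)).2 this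
  have hβ : Θ - m * ⌊Θ / m⌋ < m := by
    have := Int.lt_floor_add_one (Θ / m)
    rw [div_lt_iff₀ hm] at this
    linarith
  dsimp only
  set t' : ℝ := t - (P - ⌈Θ / m⌉)
  have ht't : m * t' ≤ m * t := mul_le_mul_of_nonneg_left (by simp only [t']; linarith) hm.le
  split_ifs with h1 h2
  · positivity
  · have hk : (0 : ℝ) ≤ ⌊t' / P⌋ := by
      exact_mod_cast Int.floor_nonneg.2 (div_nonneg (not_lt.1 h1) hP.le)
    set k : ℝ := (⌊t' / P⌋ : ℝ)
    have hkΘ : k * Θ ≤ k * (m * P) := mul_le_mul_of_nonneg_left hcap hk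
    have hx : 0 < m * (t' - P * k) := mul_pos hm (by linarith [h2.1])
    -- If the processors were fully dedicated, `y` would be `0` and `[1, y]` empty; so strictness
    -- survives in the branch without the loss `m' - β`.
    have hlt : Θ < m * P := by
      rcases hcap.lt_or_eq with h | h
      · exact h
      · have : Θ / m = P := by rw [h]; field_simp
        have h3 := h2.1.trans h2.2
        rw [this] at h3
        simp only [P, Int.floor_natCast] at h3
        norm_num at h3
    rcases max_cases 0 (m * (t' - P * k) - (m * P - Θ)) with ⟨h, _⟩ | ⟨h, _⟩ <;> rw [h] <;> nlinarith
  · have hk : (0 : ℝ) ≤ ⌊t' / P⌋ := by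
      exact_mod_cast Int.floor_nonneg.2 (div_nonneg (not_lt.1 h1) hP.le)
    have hx0 : P * ⌊t' / P⌋ ≤ t' := by
      have := Int.floor_le (t' / P)
      rw [le_div_iff₀ hP] at this
      linarith
    set k : ℝ := (⌊t' / P⌋ : ℝ)
    have hkΘ : k * Θ ≤ k * (m * P) := mul_le_mul_of_nonneg_left hcap hk
    have hx : 0 ≤ m * (t' - P * k) := mul_nonneg hm.le (by linarith)
    rcases max_cases 0 (m * (t' - P * k) - (m * P - Θ)) with ⟨h, _⟩ | ⟨h, _⟩ <;> rw [h] <;> nlinarith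

/-- Only three properties of the cumulative supply `F` matter. The window is compared with a run of
whole periods, paying `m'` per unit of time by which the run overshoots the window at either end.
Writing `a = p Π + ρ`, runs starting at the boundary `p + 1` lose nothing on the left, and those
starting at `p` lose `m' ρ`. -/
lemma MPR.sbf_le_cumulative (Γ : MPR) (F : ℝ → ℝ)
    (mono : ∀ u v, 0 ≤ u → u ≤ v → F u ≤ F v)
    (lip : ∀ u v, 0 ≤ u → u ≤ v → F v - F u ≤ Γ.procs * (v - u))
    (per : ∀ j : ℕ, Γ.capacity ≤ F (((j : ℝ) + 1) * Γ.period) - F ((j : ℝ) * Γ.period))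
    (a t : ℕ) : Γ.sbf t ≤ F (a + t) - F a := by
  have hP : (0 : ℝ) < Γ.period := by exact_mod_cast Γ.period_pos
  have hm : (0 : ℝ) < Γ.procs := by exact_mod_cast Γ.procs_pos
  have hΘ := Γ.capacity_nonneg
  have hcap := Γ.capacity_le
  have multi : ∀ i K : ℕ, K * Γ.capacity ≤
      F ((i + K : ℝ) * Γ.period) - F ((i : ℝ) * Γ.period) := by
    intro i K
    induction K with
    | zero => simp
    | succ K ih =>
      have := per (i + K)
      push_cast at this ⊢
      rw [← add_assoc]
      linarith
  have key : ∀ i K : ℕ, K * Γ.capacity - Γ.procs * max 0 ((i + K : ℝ) * Γ.period - (a + t))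
      - Γ.procs * max 0 (a - (i : ℝ) * Γ.period) ≤ F (a + t) - F a := by
    intro i K
    have h0 := multi i K
    have h1 : F ((i + K : ℝ) * Γ.period) - Γ.procs * max 0 ((i + K : ℝ) * Γ.period - (a + t))
        ≤ F (a + t) := by
      rcases le_total ((i + K : ℝ) * Γ.period) (a + t) with h | h
      · have := mono _ _ (by positivity) h
        rw [max_eq_left (by linarith)]; linarith
      · have := lip _ _ (by positivity) h
        rw [max_eq_right (by linarith)]; linarith
    have h2 : F a ≤ F ((i : ℝ) * Γ.period) + Γ.procs * max 0 (a - (i : ℝ) * Γ.period) := by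
      rcases le_total (a : ℝ) ((i : ℝ) * Γ.period) with h | h
      · have := mono _ _ (by positivity) h
        rw [max_eq_left (by linarith)]; linarith
      · have := lip _ _ (by positivity) h
        rw [max_eq_right (by linarith)]; linarith
    linarith
  obtain ⟨p, ρ, hρ, ha⟩ : ∃ p ρ : ℕ, ρ < Γ.period ∧ a = p * Γ.period + ρ :=
    ⟨a / Γ.period, a % Γ.period, Nat.mod_lt _ Γ.period_pos, by
      rw [mul_comm]; exact (Nat.div_add_mod _ _).symm⟩
  have haR : (a : ℝ) = p * Γ.period + ρ := by exact_mod_cast ha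
  have hρR : (ρ : ℝ) < Γ.period := by exact_mod_cast hρ
  have nonneg : 0 ≤ F (a + t) - F a := by
    have := mono a (a + t) (by positivity) (by simp)
    linarith
  have hα1 : Γ.procs * (⌊Γ.capacity / Γ.procs⌋ : ℝ) ≤ Γ.capacity := by
    have := Int.floor_le (Γ.capacity / Γ.procs)
    rw [le_div_iff₀ hm] at this
    linarith
  have hα2 : Γ.capacity < Γ.procs * (⌊Γ.capacity / Γ.procs⌋ : ℝ) + Γ.procs := by
    have := Int.lt_floor_add_one (Γ.capacity / Γ.procs)
    rw [div_lt_iff₀ hm] at this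
    linarith
  have hc1 : Γ.capacity ≤ Γ.procs * (⌈Γ.capacity / Γ.procs⌉ : ℝ) := by
    have := Int.le_ceil (Γ.capacity / Γ.procs)
    rw [div_le_iff₀ hm] at this
    linarith
  have hcα : ⌈Γ.capacity / Γ.procs⌉ = ⌊Γ.capacity / Γ.procs⌋ ∨
      ⌈Γ.capacity / Γ.procs⌉ = ⌊Γ.capacity / Γ.procs⌋ + 1 := by
    have h1 := Int.ceil_le_floor_add_one (Γ.capacity / Γ.procs)
    have h2 := Int.floor_le_ceil (Γ.capacity / Γ.procs)
    omega
  unfold MPR.sbf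
  dsimp only
  set α := ⌊Γ.capacity / Γ.procs⌋
  set c := ⌈Γ.capacity / Γ.procs⌉
  set P : ℝ := (Γ.period : ℝ)
  set Θ : ℝ := Γ.capacity
  set m : ℝ := (Γ.procs : ℝ)
  set t' : ℝ := t - (P - c) with ht'
  by_cases h1 : t' < 0
  · rw [if_pos h1]; exact nonneg
  rw [if_neg h1]
  obtain ⟨k, hk⟩ : ∃ k : ℕ, ⌊t' / P⌋ = k :=
    Int.eq_ofNat_of_zero_le (Int.floor_nonneg.2 (div_nonneg (not_lt.1 h1) hP.le))
  have hx0 : P * k ≤ t' := by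
    have := Int.floor_le (t' / P)
    rw [le_div_iff₀ hP, hk] at this
    push_cast at this
    linarith
  have hx1 : t' < P * k + P := by
    have := Int.lt_floor_add_one (t' / P)
    rw [div_lt_iff₀ hP, hk] at this
    push_cast at this
    linarith
  have hkR : ((⌊t' / P⌋ : ℤ) : ℝ) = k := by rw [hk]; simp
  rw [hkR]
  -- two families of lower bounds, ending with the period boundary `p + 1 + K`
  have opt1 : ∀ K : ℕ, K * Θ - m * max 0 (K * P - t' + c - ρ) ≤ F (a + t) - F a := by
    intro K
    have := key (p + 1) K
    rw [max_eq_left (b := (a : ℝ) - _) (by push_cast; nlinarith)] at this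
    have e : ((p + 1 : ℕ) + K : ℝ) * P - (a + t) = K * P - t' + c - ρ := by
      rw [haR, ht']; push_cast; ring
    rw [e] at this
    linarith
  have opt2 : ∀ K : ℕ, (K + 1) * Θ - m * max 0 (K * P - t' + c - ρ) - m * ρ ≤ F (a + t) - F a := by
    intro K
    have := key p (K + 1)
    rw [max_eq_right (b := (a : ℝ) - _) (by rw [haR]; simp)] at this
    have e : ((p : ℕ) + (K + 1 : ℕ) : ℝ) * P - (a + t) = K * P - t' + c - ρ := by
      rw [haR, ht']; push_cast; ring
    rw [e] at this
    have e2 : (a : ℝ) - p * P = ρ := by rw [haR]; ring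
    rw [e2] at this
    push_cast at this
    linarith
  have hmax : ∀ K : ℕ, max 0 (K * P - t' + c - ρ) ≤ max 0 (K * P - t') + max 0 (c - ρ : ℝ) := by
    intro K
    refine max_le (by positivity) ?_
    linarith [le_max_right 0 (K * P - t'), le_max_right 0 (c - ρ : ℝ)]
  have hmm : ∀ K : ℕ, m * max 0 (K * P - t' + c - ρ) ≤
      m * max 0 (K * P - t') + m * max 0 (c - ρ : ℝ) := by
    intro K
    rw [← mul_add]
    exact mul_le_mul_of_nonneg_left (hmax K) hm.le
  have ek : max 0 (k * P - t') = 0 := max_eq_left (by linarith)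
  have ek1 : max 0 (((k + 1 : ℕ) : ℝ) * P - t') = (k + 1) * P - t' := by
    push_cast; exact max_eq_right (by linarith)
  -- the bound shifted by a loss that is common to both boundaries
  have shift : ∀ l : ℝ, (∀ K : ℕ, K * Θ - m * max 0 (K * P - t') - l ≤ F (a + t) - F a) →
      k * Θ + max 0 (m * (t' - P * k) - (m * P - Θ)) - l ≤ F (a + t) - F a := by
    intro l hl
    have h2 := hl k
    have h3 := hl (k + 1)
    rw [ek] at h2
    rw [ek1] at h3
    push_cast at h3
    rcases max_cases 0 (m * (t' - P * k) - (m * P - Θ)) with ⟨h, _⟩ | ⟨h, _⟩ <;> rw [h] <;> nlinarith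
  have hβ : 0 ≤ m - (Θ - m * α) := by linarith
  -- no loss is needed unless the window starts before `c`, and then only if `c = α + 1`
  have exactBound : (c : ℝ) ≤ ρ ∨ c = α →
      k * Θ + max 0 (m * (t' - P * k) - (m * P - Θ)) ≤ F (a + t) - F a := by
    intro h
    have := shift 0 (fun K => ?_)
    · linarith
    by_cases hcρ : (c : ℝ) ≤ ρ
    · have h2 := opt1 K
      have h3 := hmm K
      rw [max_eq_left (b := (c - ρ : ℝ)) (by linarith)] at h3
      linarith
    · have hca : (c : ℝ) = α := by exact_mod_cast h.resolve_left hcρ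
      have h2 := opt2 K
      have h3 := hmm K
      rw [max_eq_right (b := (c - ρ : ℝ)) (by linarith)] at h3
      -- When `m'` divides `Θ`, the additional period gained on the left exactly pays for its `m' c`
      -- units of overshoot.
      have : Θ = m * c := le_antisymm hc1 (by rw [hca]; exact hα1)
      nlinarith
  by_cases hex : (c : ℝ) ≤ ρ ∨ c = α
  · split_ifs <;> linarith [exactBound hex]
  have hcρ : (ρ : ℝ) + 1 ≤ c := by
    have : ¬ (c ≤ (ρ : ℤ)) := fun h => hex (Or.inl (by exact_mod_cast h))
    have : (ρ : ℤ) + 1 ≤ c := by omega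
    exact_mod_cast this
  have hca : (c : ℝ) = α + 1 := by
    exact_mod_cast hcα.resolve_left fun h => hex (Or.inr h)
  -- Starting at `p` costs `m' c - Θ = m' - β` in general. For `x ∈ [1, y]` the run of `k + 1`
  -- periods suffices: `x ≥ 1` saves one unit of overshoot, leaving at least `k Θ + β`, while `x ≤
  -- y` makes the maximum at most `β`.
  split_ifs with h2
  · have h3 := opt2 k
    have h4 : max 0 (k * P - t' + c - ρ) ≤ c - ρ - 1 := max_le (by linarith) (by linarith [h2.1])
    have h5 := mul_le_mul_of_nonneg_left h4 hm.le
    have h6 : m * (t' - P * k) ≤ m * (P - α) := mul_le_mul_of_nonneg_left h2.2 hm.le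
    rw [hca] at h5 h3
    rcases max_cases 0 (m * (t' - P * k) - (m * P - Θ)) with ⟨h, _⟩ | ⟨h, _⟩ <;> rw [h] <;> linarith
  · refine shift _ fun K => ?_
    have h3 := opt2 K
    have h4 := hmm K
    rw [max_eq_right (b := (c - ρ : ℝ)) (by linarith), hca] at h4
    rw [hca] at h3
    linarith

lemma MPR.IsSupply.intervalIntegrable {Γ : MPR} {s : ℝ → ℕ} (hs : Γ.IsSupply s) {u v : ℝ}
    (hu : 0 ≤ u) (hv : 0 ≤ v) : IntervalIntegrable (fun t => (s t : ℝ)) volume u v := by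
  rw [intervalIntegrable_iff]
  refine Measure.integrableOn_of_bounded (M := Γ.procs) (by simp)
    (measurable_from_top.comp hs.1).aestronglyMeasurable ?_
  filter_upwards [ae_restrict_mem measurableSet_uIoc] with t ht
  have : 0 ≤ t := (le_min hu hv).trans ht.1.le
  simpa using hs.2.1 t this

lemma MPR.IsSupply.sbf_le_integral {Γ : MPR} {s : ℝ → ℕ} (hs : Γ.IsSupply s) (a t : ℕ) :
    Γ.sbf t ≤ ∫ u in (a : ℝ)..(a + t), (s u : ℝ) := by
  have sub : ∀ u v : ℝ, 0 ≤ u → 0 ≤ v →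
      (∫ x in (0 : ℝ)..v, (s x : ℝ)) - ∫ x in (0 : ℝ)..u, (s x : ℝ) = ∫ x in u..v, (s x : ℝ) :=
    fun u v hu hv => intervalIntegral.integral_interval_sub_left
      (hs.intervalIntegrable le_rfl hv) (hs.intervalIntegrable le_rfl hu)
  have := Γ.sbf_le_cumulative (fun v => ∫ x in (0 : ℝ)..v, (s x : ℝ)) ?_ ?_ ?_ a t
  · rwa [sub _ _ (by positivity) (by positivity)] at this
  · intro u v hu huv
    have h1 := sub u v hu (hu.trans huv)
    have h2 : 0 ≤ ∫ x in u..v, (s x : ℝ) :=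
      intervalIntegral.integral_nonneg huv fun _ _ => by positivity
    linarith
  · intro u v hu huv
    rw [sub u v hu (hu.trans huv)]
    calc ∫ x in u..v, (s x : ℝ) ≤ ∫ x in u..v, (Γ.procs : ℝ) :=
          intervalIntegral.integral_mono_on huv (hs.intervalIntegrable hu (hu.trans huv))
            intervalIntegrable_const fun x hx => by exact_mod_cast hs.2.1 x (hu.trans hx.1)
      _ = Γ.procs * (v - u) := by simp [mul_comm]
  · intro j
    rw [sub _ _ (by positivity) (by positivity)]
    exact hs.2.2 j

/-! ### The workload bound -/

lemma add_card_mul_le_of_separated {T : ℕ} (R : Finset ℕ)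
    (hsep : ∀ x ∈ R, ∀ y ∈ R, x < y → x + T ≤ y) (lo : ℕ) (hlo : ∀ x ∈ R, lo ≤ x) :
    ∀ hi, R.Nonempty → (∀ x ∈ R, x ≤ hi) → lo + R.card * T ≤ hi + T := by
  induction R using Finset.induction_on_max with
  | empty => intro _ h; exact absurd h (by simp)
  | insert x R hx ih =>
    intro hi _ hhi
    have hxR : x ∉ R := fun h => lt_irrefl _ (hx x h)
    rw [Finset.card_insert_of_notMem hxR]
    have hxhi := hhi x (Finset.mem_insert_self _ _)
    rcases R.eq_empty_or_nonempty with rfl | hne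
    · have := hlo x (Finset.mem_insert_self _ _)
      simp; omega
    · have hT : ∀ y ∈ R, y + T ≤ x := fun y hy => hsep y (Finset.mem_insert_of_mem hy) x
        (Finset.mem_insert_self _ _) (hx y hy)
      have := ih (fun x hx y hy => hsep x (Finset.mem_insert_of_mem hx) y
        (Finset.mem_insert_of_mem hy)) (fun y hy => hlo y (Finset.mem_insert_of_mem hy))
        (x - T) hne (fun y hy => by have := hT y hy; omega)
      obtain ⟨y, hy⟩ := hne
      have := hT y hy
      rw [add_mul]
      omega

lemma SporadicTask.count_nonneg (τ : SporadicTask) {t : ℝ} (ht : 0 ≤ t) : 0 ≤ τ.count t := by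
  have hT : (0 : ℝ) < τ.T := by exact_mod_cast τ.T_pos
  have hD : (τ.D : ℝ) ≤ τ.T := by exact_mod_cast τ.D_le_T
  unfold SporadicTask.count
  exact Int.cast_nonneg (Int.floor_nonneg.2 (div_nonneg (by linarith) hT.le))

lemma SporadicTask.CI_nonneg (τ : SporadicTask) (t : ℝ) : 0 ≤ τ.CI t :=
  le_min τ.C_nonneg (le_max_left _ _)

lemma SporadicTask.natCast_le_count (τ : SporadicTask) {t : ℝ} {c : ℕ}
    (h : (c : ℝ) * τ.T ≤ t + (τ.T - τ.D)) : (c : ℝ) ≤ τ.count t := by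
  have hT : (0 : ℝ) < τ.T := by exact_mod_cast τ.T_pos
  have : (c : ℤ) ≤ ⌊(t + ((τ.T : ℝ) - τ.D)) / τ.T⌋ := by
    rw [Int.le_floor, le_div_iff₀ hT]
    exact_mod_cast h
  unfold SporadicTask.count
  exact_mod_cast this

/-- At most `count (d - a)` jobs are released at or after `a` with deadline at most `d`. -/
lemma SporadicTask.card_le_count (τ : SporadicTask) {a d : ℕ} (had : a ≤ d) (R : Finset ℕ)
    (hsep : ∀ x ∈ R, ∀ y ∈ R, x < y → x + τ.T ≤ y) (ha : ∀ x ∈ R, a ≤ x)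
    (hd : ∀ x ∈ R, x + τ.D ≤ d) : (R.card : ℝ) ≤ τ.count ((d : ℝ) - a) := by
  have had' : (a : ℝ) ≤ d := by exact_mod_cast had
  rcases R.eq_empty_or_nonempty with rfl | hne
  · simpa using τ.count_nonneg (sub_nonneg.2 had')
  · apply τ.natCast_le_count
    have := add_card_mul_le_of_separated R hsep a ha (d - τ.D) hne
      fun x hx => by have := hd x hx; omega
    obtain ⟨x, hx⟩ := hne
    have h2 := hd x hx
    have h3 : a + R.card * τ.T + τ.D ≤ d + τ.T := by omega
    have h4 : (a : ℝ) + R.card * τ.T + τ.D ≤ d + τ.T := by exact_mod_cast h3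
    linarith

/-- Workload of a task without carry-in: `v ρ` is the work done in `[a, d]` on the job released
at `ρ`. -/
lemma SporadicTask.sum_le_count_mul (τ : SporadicTask) {a d : ℕ} (had : a ≤ d) (R : Finset ℕ)
    (hsep : ∀ x ∈ R, ∀ y ∈ R, x < y → x + τ.T ≤ y) (hd : ∀ x ∈ R, x + τ.D ≤ d)
    (v : ℕ → ℝ) (hv : ∀ x ∈ R, v x ≤ τ.C) (hearly : ∀ x ∈ R, x < a → v x ≤ 0) :
    ∑ x ∈ R, v x ≤ τ.count ((d : ℝ) - a) * τ.C := by
  rw [← Finset.sum_filter_add_sum_filter_not R (fun x => a ≤ x)]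
  have h1 : ∑ x ∈ R with a ≤ x, v x ≤ (R.filter (a ≤ ·)).card * τ.C := by
    rw [← nsmul_eq_mul]
    exact Finset.sum_le_card_nsmul _ _ _ fun x hx => hv x (Finset.mem_filter.1 hx).1
  have h2 : ∑ x ∈ R with ¬ a ≤ x, v x ≤ 0 := Finset.sum_nonpos fun x hx =>
    hearly x (Finset.mem_filter.1 hx).1 (not_le.1 (Finset.mem_filter.1 hx).2)
  have h3 := τ.card_le_count had (R.filter (a ≤ ·))
    (fun x hx y hy => hsep x (Finset.mem_filter.1 hx).1 y (Finset.mem_filter.1 hy).1)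
    (fun x hx => (Finset.mem_filter.1 hx).2) fun x hx => hd x (Finset.mem_filter.1 hx).1
  have h4 := mul_le_mul_of_nonneg_right h3 τ.C_nonneg
  linarith

/-- Workload of a task, with possible carry-in: `v ρ` is the work done in `[a, d]` on the job
released at `ρ`. -/
lemma SporadicTask.sum_le_W (τ : SporadicTask) {a d : ℕ} (had : a ≤ d) (R : Finset ℕ)
    (hsep : ∀ x ∈ R, ∀ y ∈ R, x < y → x + τ.T ≤ y) (hd : ∀ x ∈ R, x + τ.D ≤ d)
    (v : ℕ → ℝ) (hv : ∀ x ∈ R, v x ≤ τ.C)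
    (hwin : ∀ x ∈ R, v x ≤ max 0 ((x : ℝ) + τ.D - a)) :
    ∑ x ∈ R, v x ≤ τ.W ((d : ℝ) - a) := by
  have hCI := τ.CI_nonneg ((d : ℝ) - a)
  by_cases hc : ∃ x₀ ∈ R, x₀ < a ∧ a < x₀ + τ.D
  swap
  · have := τ.sum_le_count_mul had R hsep hd v hv fun x hx hxa => by
      refine (hwin x hx).trans (max_le le_rfl ?_)
      have : x + τ.D ≤ a := not_lt.1 fun h => hc ⟨x, hx, hxa, h⟩
      have : (x : ℝ) + τ.D ≤ a := by exact_mod_cast this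
      linarith
    unfold SporadicTask.W
    linarith
  -- Since `D ≤ T`, at most one job released before `a` has its deadline after `a`; older or other
  -- early jobs contribute nothing.
  obtain ⟨x₀, hx₀, hxa, hax⟩ := hc
  have hDT := τ.D_le_T
  rw [← Finset.sum_filter_add_sum_filter_not R (fun x => a ≤ x)]
  set B := R.filter (a ≤ ·) with hB
  have hsepB : ∀ x ∈ B, ∀ y ∈ B, x < y → x + τ.T ≤ y := fun x hx y hy =>
    hsep x (Finset.mem_filter.1 hx).1 y (Finset.mem_filter.1 hy).1
  have h1 : ∑ x ∈ B, v x ≤ B.card * τ.C := by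
    rw [← nsmul_eq_mul]
    exact Finset.sum_le_card_nsmul _ _ _ fun x hx => hv x (Finset.mem_filter.1 hx).1
  have h2 : ∑ x ∈ R with ¬ a ≤ x, v x ≤ v x₀ := by
    rw [← Finset.add_sum_erase _ v (Finset.mem_filter.2 ⟨hx₀, not_le.2 hxa⟩)]
    have : ∑ x ∈ (R.filter (¬ a ≤ ·)).erase x₀, v x ≤ 0 := by
      refine Finset.sum_nonpos fun x hx => ?_
      obtain ⟨hne, hx⟩ := Finset.mem_erase.1 hx
      obtain ⟨hxR, hxa'⟩ := Finset.mem_filter.1 hx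
      refine (hwin x hxR).trans (max_le le_rfl ?_)
      have : x + τ.D ≤ a := by
        rcases lt_or_gt_of_ne hne with h | h
        · have := hsep x hxR x₀ hx₀ h; omega
        · have := hsep x₀ hx₀ x hxR h; omega
      have : (x : ℝ) + τ.D ≤ a := by exact_mod_cast this
      linarith
    linarith
  have h3 : (B.card : ℝ) ≤ τ.count ((d : ℝ) - a) := τ.card_le_count had B hsepB
    (fun x hx => (Finset.mem_filter.1 hx).2) fun x hx => hd x (Finset.mem_filter.1 hx).1
  have hvx := hv x₀ hx₀
  have hwx := hwin x₀ hx₀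
  have hC := τ.C_nonneg
  unfold SporadicTask.W
  -- If fewer than `count` jobs are released from `a` on, the carry-in job is paid for as one of the
  -- `count` full jobs. Otherwise `count` releases follow `x₀`, which pushes its deadline down to at
  -- most `d - count * T` and leaves it the window in `CI`.
  rcases h3.lt_or_eq with h | h
  · have h4 : (B.card : ℝ) + 1 ≤ τ.count ((d : ℝ) - a) := by
      unfold SporadicTask.count at h ⊢
      have : (B.card : ℤ) < ⌊((d : ℝ) - a + ((τ.T : ℝ) - τ.D)) / τ.T⌋ := by exact_mod_cast h
      exact_mod_cast this
    have h5 := mul_le_mul_of_nonneg_right h4 hC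
    linarith
  · have h4 : v x₀ ≤ τ.CI ((d : ℝ) - a) := by
      refine le_min hvx (hwx.trans (max_le_max le_rfl ?_))
      have hnot : x₀ ∉ B := fun hx => absurd (Finset.mem_filter.1 hx).2 (not_le.2 hxa)
      have hsub : insert x₀ B ⊆ R := Finset.insert_subset hx₀ (Finset.filter_subset _ _)
      have h5 := add_card_mul_le_of_separated (T := τ.T) (insert x₀ B)
        (fun x hx y hy => hsep x (hsub hx) y (hsub hy)) x₀ (fun x hx => by
          rcases Finset.mem_insert.1 hx with rfl | hx
          · exact le_rfl
          · exact hxa.le.trans (Finset.mem_filter.1 hx).2) (d - τ.D) (by simp)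
        fun x hx => by have := hd x (hsub hx); omega
      rw [Finset.card_insert_of_notMem hnot, add_mul] at h5
      have h6 := hd x₀ hx₀
      have h7 : x₀ + B.card * τ.T + τ.D ≤ d := by omega
      have h8 : (x₀ : ℝ) + B.card * τ.T + τ.D ≤ d := by exact_mod_cast h7
      rw [h] at h8
      linarith
    rw [h] at h1
    linarith

/-! ### The demand bound -/

lemma sum_le_sumLargest {n q : ℕ} (v : Fin n → ℝ) (hv : ∀ i, 0 ≤ v i) (S : Finset (Fin n))
    (hS : S.card ≤ q) : ∑ i ∈ S, v i ≤ sumLargest q v := by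
  have hSn : S.card ≤ n := by simpa using S.card_le_univ
  obtain ⟨L, hSL, -, hL⟩ := Finset.exists_subsuperset_card_eq (Finset.subset_univ S)
    (le_min hS hSn) (by simp)
  calc ∑ i ∈ S, v i ≤ ∑ i ∈ L, v i :=
        Finset.sum_le_sum_of_subset_of_nonneg hSL fun i _ _ => hv i
    _ ≤ _ := Finset.le_sup' (fun L => ∑ i ∈ L, v i)
        (Finset.mem_powersetCard.2 ⟨Finset.subset_univ _, hL⟩)

lemma Ihat_le_Ibar {n : ℕ} (τ : Fin n → SporadicTask) (k : Fin n) (A : ℝ) (i : Fin n) :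
    Ihat τ k A i ≤ Ibar τ k A i := by
  unfold Ihat Ibar
  dsimp only
  split_ifs
  · exact min_le_min_right _ (by linarith [(τ k).CI_nonneg (A + (τ k).D)])
  · exact min_le_min_right _ (by linarith [(τ i).CI_nonneg (A + (τ k).D)])

/-- The job under analysis is itself counted, which pays for the `C` subtracted in `Ihat` and keeps
that bound non-negative. -/
lemma SporadicTask.one_le_count (τ : SporadicTask) {A : ℝ} (hA : 0 ≤ A) :
    1 ≤ τ.count (A + τ.D) := by
  have := τ.natCast_le_count (t := A + τ.D) (c := 1) (by push_cast; linarith)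
  exact_mod_cast this

lemma Ihat_nonneg {n : ℕ} (τ : Fin n → SporadicTask) (k : Fin n) {A : ℝ} (hA : 0 ≤ A)
    (i : Fin n) : 0 ≤ Ihat τ k A i := by
  have hD : (0 : ℝ) ≤ (τ k).D := by positivity
  unfold Ihat SporadicTask.W
  dsimp only
  split_ifs
  · refine le_min ?_ hA
    nlinarith [(τ k).one_le_count hA, (τ k).C_nonneg]
  · refine le_min ?_ (by linarith [(τ k).C_le_D])
    have := mul_nonneg ((τ i).count_nonneg (t := A + (τ k).D) (by linarith)) (τ i).C_nonneg
    linarith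

/-- The demand bound dominates the bound with carry-in for any `m' - 1` tasks. -/
lemma le_dem {n : ℕ} (τ : Fin n → SporadicTask) (m : ℕ) (k : Fin n) (A : ℝ)
    (S : Finset (Fin n)) (hS : S.card ≤ m - 1) :
    m * (τ k).C + ∑ i, (if i ∈ S then Ibar τ k A i else Ihat τ k A i) ≤ dem τ m k A := by
  have h1 := sum_le_sumLargest (fun i => Ibar τ k A i - Ihat τ k A i)
    (fun i => sub_nonneg.2 (Ihat_le_Ibar τ k A i)) S hS
  have h2 : ∑ i, (if i ∈ S then Ibar τ k A i else Ihat τ k A i) =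
      ∑ i, Ihat τ k A i + ∑ i ∈ S, (Ibar τ k A i - Ihat τ k A i) := by
    rw [← Finset.univ_inter S, ← Finset.sum_ite_mem, ← Finset.sum_add_distrib]
    refine Finset.sum_congr rfl fun i _ => ?_
    simp only [Finset.univ_inter]
    split_ifs <;> ring
  unfold dem
  linarith

/-! ### Service and execution windows -/

section Schedule

variable {n : ℕ} {τ : Fin n → SporadicTask} {s : ℝ → ℕ} {J : Jobs τ}
  {exec : Fin n × ℕ → Set ℝ}

lemma service_mono (exec : Fin n × ℕ → Set ℝ) (j : Fin n × ℕ) : Monotone (service exec j) :=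
  fun _ _ h => measureReal_mono (Set.inter_subset_inter_right _ (Set.Icc_subset_Icc_right h))
    (measure_ne_top_of_subset Set.inter_subset_right (by simp))

lemma service_le_add (exec : Fin n × ℕ → Set ℝ) (j : Fin n × ℕ) {u v : ℝ} (huv : u ≤ v) :
    service exec j v ≤ service exec j u + (v - u) := by
  have hsub : exec j ∩ Set.Icc 0 v ⊆ (exec j ∩ Set.Icc 0 u) ∪ Set.Icc u v := by
    rintro x ⟨hx, h0, hxv⟩
    rcases le_total x u with h | h
    · exact Or.inl ⟨hx, h0, h⟩
    · exact Or.inr ⟨h, hxv⟩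
  calc service exec j v ≤ volume.real ((exec j ∩ Set.Icc 0 u) ∪ Set.Icc u v) :=
        measureReal_mono hsub (measure_union_ne_top
          (measure_ne_top_of_subset Set.inter_subset_right (by simp)) (by simp))
    _ ≤ service exec j u + volume.real (Set.Icc u v) := measureReal_union_le _ _
    _ = service exec j u + (v - u) := by rw [Real.volume_real_Icc_of_le huv]

lemma service_continuous (exec : Fin n × ℕ → Set ℝ) (j : Fin n × ℕ) :
    Continuous (service exec j) := by
  refine (LipschitzWith.of_le_add fun u v => ?_).continuous
  rcases le_total u v with h | h
  · linarith [service_mono exec j h, dist_nonneg (x := u) (y := v)]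
  · have := service_le_add exec j h
    rwa [Real.dist_eq, abs_of_nonneg (by linarith)]

lemma service_zero (exec : Fin n × ℕ → Set ℝ) (j : Fin n × ℕ) : service exec j 0 = 0 := by
  refine le_antisymm ?_ measureReal_nonneg
  calc service exec j 0 ≤ volume.real (Set.Icc (0 : ℝ) 0) :=
        measureReal_mono Set.inter_subset_right (by simp)
    _ = 0 := by simp [measureReal_def]

/-- Service is continuous, so an excess would require passing an instant where it equals the cost;
after that the job is no longer pending and cannot execute. -/
lemma IsGEDF.service_le_cost (hE : IsGEDF s J exec) {j : Fin n × ℕ} (hj : j.2 ∈ J.release j.1)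
    {t : ℝ} (ht : 0 ≤ t) : service exec j t ≤ J.cost j := by
  by_contra! hlt
  obtain ⟨u, ⟨hu0, hut⟩, hu⟩ := intermediate_value_Icc ht (service_continuous exec j).continuousOn
    (show J.cost j ∈ Set.Icc _ _ from
      ⟨by rw [service_zero]; exact J.cost_nonneg _ _ hj, hlt.le⟩)
  have : service exec j t ≤ service exec j u := by
    refine measureReal_mono ?_ (measure_ne_top_of_subset Set.inter_subset_right (by simp))
    rintro x ⟨hx, h0, _⟩
    refine ⟨hx, h0, le_of_not_gt fun hux => ?_⟩
    have h1 := (hE.pending x h0 j hx).2.2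
    have h2 := service_mono exec j hux.le
    linarith
  linarith

/-- Up to time `d`, a job with deadline at most `d` executes only before its deadline, provided
that the deadlines before `d` are met. -/
lemma IsGEDF.lt_deadline (hE : IsGEDF s J exec) {d : ℕ}
    (hmeet : ∀ i, ∀ r ∈ J.release i, deadline τ (i, r) < d →
      J.cost (i, r) ≤ service exec (i, r) (deadline τ (i, r)))
    {j : Fin n × ℕ} {t : ℝ} (ht0 : 0 ≤ t) (htd : t < d) (ht : t ∈ exec j) :
    t < deadline τ j := by
  obtain ⟨hrel, -, hsv⟩ := hE.pending t ht0 j ht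
  by_contra! hle
  have hlt : deadline τ j < d := by exact_mod_cast hle.trans_lt htd
  have h1 := hmeet j.1 j.2 hrel hlt
  have h2 := service_mono exec j hle
  exact absurd hsv (not_lt.2 (h1.trans h2))

/-- If some available processor does not execute a job with deadline at most `d`, then all
unfinished jobs with deadline at most `d` execute. -/
lemma IsGEDF.pending_subset_of_idle (hE : IsGEDF s J exec) {d : ℕ} {t : ℝ} (ht0 : 0 ≤ t)
    (hidle : {j | t ∈ exec j ∧ deadline τ j ≤ d}.encard < (s t : ℕ∞)) {j : Fin n × ℕ}
    (hj : Pending J exec t j) (hjd : deadline τ j ≤ d) : t ∈ exec j := by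
  by_contra hn
  have h1 := hE.work_conserving t ht0 ⟨j, hj, hn⟩
  have h2 : {j | t ∈ exec j} = {j | t ∈ exec j ∧ deadline τ j ≤ d} := by
    ext j'
    exact ⟨fun h => ⟨h, (hE.edf t ht0 j' j h hj hn).trans hjd⟩, fun h => h.1⟩
  rw [← h1, h2] at hidle
  exact lt_irrefl _ hidle

/-- The tasks with an unfinished job at time `a` that was released earlier and has deadline at
most `d`. -/
def CarryIn (J : Jobs τ) (exec : Fin n × ℕ → Set ℝ) (a d : ℕ) (i : Fin n) : Prop :=
  ∃ ρ < a, deadline τ (i, ρ) ≤ d ∧ Pending J exec a (i, ρ)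

open Classical in
-- Carry-in jobs are released by `a - 1 ≤ t`, so all are pending at the idle instant `t` and hence
-- execute there. Different tasks give different executing jobs.
lemma IsGEDF.card_carryIn_lt (hE : IsGEDF s J exec) {a d : ℕ} {t : ℝ} (ht0 : 0 ≤ t)
    (hta : (a : ℝ) ≤ t + 1) (hta' : t ≤ a)
    (hidle : {j | t ∈ exec j ∧ deadline τ j ≤ d}.encard < (s t : ℕ∞)) :
    (Finset.univ.filter (CarryIn J exec a d)).card < s t := by
  set S := Finset.univ.filter (CarryIn J exec a d) with hS
  have hex : ∀ i, ∃ ρ : ℕ, i ∈ S → t ∈ exec (i, ρ) ∧ deadline τ (i, ρ) ≤ d := by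
    intro i
    by_cases hi : i ∈ S
    · obtain ⟨ρ, hρ, hd, hrel, -, hsv⟩ := (Finset.mem_filter.1 hi).2
      refine ⟨ρ, fun _ => ⟨hE.pending_subset_of_idle ht0 hidle ⟨hrel, ?_, ?_⟩ hd, hd⟩⟩
      · have : (ρ : ℝ) + 1 ≤ a := by exact_mod_cast hρ
        dsimp only; linarith
      · exact (service_mono exec (i, ρ) hta').trans_lt hsv
    · exact ⟨0, fun h => absurd h hi⟩
  choose f hf using hex
  have hsub : ((S.image fun i => (i, f i) : Finset (Fin n × ℕ)) : Set (Fin n × ℕ)) ⊆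
      {j | t ∈ exec j ∧ deadline τ j ≤ d} := by
    intro j hj
    obtain ⟨i, hi, rfl⟩ := Finset.mem_image.1 (Finset.mem_coe.1 hj)
    exact hf i hi
  have h1 := (Set.encard_le_encard hsub).trans_lt hidle
  rw [Set.encard_coe_eq_coe_finsetCard, Finset.card_image_of_injective _
    fun x y h => (Prod.ext_iff.1 h).1] at h1
  exact_mod_cast h1

/-- The work done on the job `j` in `[a, d)` while the job `j₀` does not execute. -/
noncomputable def interference (exec : Fin n × ℕ → Set ℝ) (j₀ : Fin n × ℕ) (a d : ℕ)
    (j : Fin n × ℕ) : ℝ :=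
  volume.real ((exec j \ exec j₀) ∩ Set.Ico (a : ℝ) d)

lemma interference_le_of_subset {j₀ j : Fin n × ℕ} {a d : ℕ} {u v : ℝ} (huv : u ≤ v)
    (h : (exec j \ exec j₀) ∩ Set.Ico (a : ℝ) d ⊆ Set.Ico u v) :
    interference exec j₀ a d j ≤ v - u :=
  calc interference exec j₀ a d j ≤ volume.real (Set.Ico u v) := measureReal_mono h (by simp)
    _ = v - u := Real.volume_real_Ico_of_le huv

lemma interference_self (exec : Fin n × ℕ → Set ℝ) (j₀ : Fin n × ℕ) (a d : ℕ) :
    interference exec j₀ a d j₀ = 0 := by simp [interference]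

lemma IsGEDF.interference_le_C (hE : IsGEDF s J exec) (j₀ : Fin n × ℕ) (a d : ℕ) {i : Fin n}
    {ρ : ℕ} (hρ : ρ ∈ J.release i) : interference exec j₀ a d (i, ρ) ≤ (τ i).C :=
  calc interference exec j₀ a d (i, ρ) ≤ service exec (i, ρ) d := by
        refine measureReal_mono ?_ (measure_ne_top_of_subset Set.inter_subset_right (by simp))
        rintro x ⟨⟨hx, _⟩, hxa, hxd⟩
        exact ⟨hx, (Nat.cast_nonneg a).trans hxa, hxd.le⟩
    _ ≤ J.cost (i, ρ) := hE.service_le_cost hρ (Nat.cast_nonneg d)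
    _ ≤ (τ i).C := J.cost_le i ρ hρ

lemma IsGEDF.interference_le_window (hE : IsGEDF s J exec) (j₀ : Fin n × ℕ) (a : ℕ) {d : ℕ}
    (hmeet : ∀ i, ∀ r ∈ J.release i, deadline τ (i, r) < d →
      J.cost (i, r) ≤ service exec (i, r) (deadline τ (i, r))) (i : Fin n) (ρ : ℕ) :
    interference exec j₀ a d (i, ρ) ≤ max 0 ((ρ : ℝ) + (τ i).D - a) := by
  have h : (exec (i, ρ) \ exec j₀) ∩ Set.Ico (a : ℝ) d ⊆
      Set.Ico (a : ℝ) (max a ((ρ : ℝ) + (τ i).D)) := by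
    rintro x ⟨⟨hx, _⟩, hxa, hxd⟩
    have := hE.lt_deadline hmeet ((Nat.cast_nonneg a).trans hxa) hxd hx
    simp only [deadline] at this
    push_cast at this
    exact ⟨hxa, this.trans_le (le_max_right _ _)⟩
  refine (interference_le_of_subset (le_max_left _ _) h).trans ?_
  rcases le_total (a : ℝ) ((ρ : ℝ) + (τ i).D) with h | h
  · rw [max_eq_right h]; exact le_max_right _ _
  · rw [max_eq_left h]; simp

/-- A job released before `a` with deadline at most `d` does not execute in `[a, d)` unless its
task carries in. -/
lemma IsGEDF.interference_eq_zero (hE : IsGEDF s J exec) (j₀ : Fin n × ℕ) {a d : ℕ} {i : Fin n}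
    {ρ : ℕ} (hρ : ρ < a) (hd : deadline τ (i, ρ) ≤ d) (hc : ¬ CarryIn J exec a d i) :
    interference exec j₀ a d (i, ρ) = 0 := by
  have : (exec (i, ρ) \ exec j₀) ∩ Set.Ico (a : ℝ) d = ∅ := by
    rw [Set.eq_empty_iff_forall_notMem]
    rintro x ⟨⟨hx, _⟩, hxa, hxd⟩
    obtain ⟨h1, h2, h3⟩ := hE.pending x ((Nat.cast_nonneg a).trans hxa) _ hx
    exact hc ⟨ρ, hρ, hd, h1, by exact_mod_cast hρ.le, (service_mono exec _ hxa).trans_lt h3⟩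
  rw [interference, this]
  simp

/-- Jobs of one task execute at disjoint times, so the sum of their interferences is at most the
measure of any set containing these times. -/
lemma IsGEDF.sum_interference_le (hE : IsGEDF s J exec) (j₀ : Fin n × ℕ) {a d : ℕ}
    (hmeet : ∀ i, ∀ r ∈ J.release i, deadline τ (i, r) < d →
      J.cost (i, r) ≤ service exec (i, r) (deadline τ (i, r))) (i : Fin n) (R : Finset ℕ)
    (X : Set ℝ) (hX : volume X ≠ ⊤)
    (hsub : ∀ ρ ∈ R, (exec (i, ρ) \ exec j₀) ∩ Set.Ico (a : ℝ) d ⊆ X) :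
    ∑ ρ ∈ R, interference exec j₀ a d (i, ρ) ≤ volume.real X := by
  unfold interference
  rw [← measureReal_biUnion_finset (h := fun ρ _ =>
    measure_ne_top_of_subset Set.inter_subset_right (by simp))]
  · exact measureReal_mono (Set.iUnion₂_subset hsub) hX
  -- The earlier job executes only before its deadline, which by `D ≤ T` does not exceed the later
  -- release.
  · have key : ∀ ρ ρ' : ℕ, ρ < ρ' → ∀ x : ℝ, 0 ≤ x → x < d → x ∈ exec (i, ρ) → x ∈ exec (i, ρ') →
        False := by
      intro ρ ρ' hlt x h0 hd hx hx'
      have h1 := hE.pending x h0 _ hx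
      have h2 := hE.pending x h0 _ hx'
      have h3 := J.separated i ρ h1.1 ρ' h2.1 hlt
      have h4 := hE.lt_deadline hmeet h0 hd hx
      have h5 := h2.2.1
      have h6 := (τ i).D_le_T
      have h7 : deadline τ (i, ρ) ≤ ρ' := by simp only [deadline]; omega
      have h8 : (deadline τ (i, ρ) : ℝ) ≤ ρ' := by exact_mod_cast h7
      dsimp only at h5
      linarith
    intro ρ _ ρ' _ hne
    refine Set.disjoint_left.2 ?_
    rintro x ⟨⟨hx, _⟩, hxa, hxd⟩ ⟨⟨hx', _⟩, _, _⟩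
    have h0 : 0 ≤ x := (Nat.cast_nonneg a).trans hxa
    rcases lt_or_gt_of_ne hne with h | h
    · exact key ρ ρ' h x h0 hxd hx hx'
    · exact key ρ' ρ h x h0 hxd hx' hx
  · exact fun ρ _ => ((hE.measurable _).diff (hE.measurable _)).inter measurableSet_Ico

open Classical in
/-- The releases of task `i` whose jobs have deadline at most `d`. -/
noncomputable def releasesUpTo (J : Jobs τ) (d : ℕ) (i : Fin n) : Finset ℕ :=
  (Finset.range (d + 1)).filter fun ρ => ρ ∈ J.release i ∧ ρ + (τ i).D ≤ d

lemma mem_releasesUpTo {d : ℕ} {i : Fin n} {ρ : ℕ} :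
    ρ ∈ releasesUpTo J d i ↔ ρ ∈ J.release i ∧ ρ + (τ i).D ≤ d := by
  simp only [releasesUpTo, Finset.mem_filter, Finset.mem_range, and_iff_right_iff_imp]
  intro h
  omega

/-- Pointwise, the supply is charged to `m'` while `j₀` executes and otherwise to the executing jobs
with deadline at most `d`; integration gives the bound. -/
lemma MPR.IsSupply.integral_le {Γ : MPR} (hs : Γ.IsSupply s) (hE : IsGEDF s J exec)
    (j₀ : Fin n × ℕ) {a d : ℕ} (had : a ≤ d)
    (hbusy : ∀ t : ℝ, a ≤ t → t < d → t ∉ exec j₀ →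
      (s t : ℕ∞) ≤ {j | t ∈ exec j ∧ deadline τ j ≤ d}.encard) :
    ∫ t in (a : ℝ)..d, (s t : ℝ) ≤ Γ.procs * volume.real (exec j₀ ∩ Set.Ico (a : ℝ) d) +
      ∑ i, ∑ ρ ∈ releasesUpTo J d i, interference exec j₀ a d (i, ρ) := by
  have had' : (a : ℝ) ≤ d := by exact_mod_cast had
  have hpt : ∀ t ∈ Set.Ico (a : ℝ) d, (s t : ℝ) ≤ (exec j₀).indicator (fun _ => (Γ.procs : ℝ)) t +
      ∑ i, ∑ ρ ∈ releasesUpTo J d i, (exec (i, ρ) \ exec j₀).indicator (fun _ => (1 : ℝ)) t := by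
    classical
    intro t ht
    have ht0 : 0 ≤ t := (Nat.cast_nonneg a).trans ht.1
    have hnn : 0 ≤ ∑ i, ∑ ρ ∈ releasesUpTo J d i,
        (exec (i, ρ) \ exec j₀).indicator (fun _ => (1 : ℝ)) t :=
      Finset.sum_nonneg fun i _ => Finset.sum_nonneg fun ρ _ =>
        Set.indicator_nonneg (fun _ _ => zero_le_one) _
    by_cases hj : t ∈ exec j₀
    · rw [Set.indicator_of_mem hj]
      have : (s t : ℝ) ≤ Γ.procs := by exact_mod_cast hs.2.1 t ht0
      linarith
    · rw [Set.indicator_of_notMem hj, zero_add, Finset.sum_sigma']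
      set H := (Finset.univ : Finset (Fin n)).sigma fun i => releasesUpTo J d i
      have h1 : {j | t ∈ exec j ∧ deadline τ j ≤ d} ⊆
          ((H.filter fun x => t ∈ exec (x.1, x.2)).image fun x => (x.1, x.2) :
            Finset (Fin n × ℕ)) := by
        rintro ⟨i, ρ⟩ ⟨h, hd⟩
        rw [Finset.mem_coe, Finset.mem_image]
        exact ⟨⟨i, ρ⟩, Finset.mem_filter.2 ⟨Finset.mem_sigma.2 ⟨Finset.mem_univ _,
          mem_releasesUpTo.2 ⟨(hE.pending t ht0 _ h).1, hd⟩⟩, h⟩, rfl⟩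
      have h2 := (hbusy t ht.1 ht.2 hj).trans (Set.encard_le_encard h1)
      rw [Set.encard_coe_eq_coe_finsetCard] at h2
      have h3 : s t ≤ (H.filter fun x => t ∈ exec (x.1, x.2)).card :=
        (by exact_mod_cast h2 : s t ≤ _).trans Finset.card_image_le
      calc (s t : ℝ) ≤ (H.filter fun x => t ∈ exec (x.1, x.2)).card := by exact_mod_cast h3
        _ = ∑ x ∈ H, if t ∈ exec (x.1, x.2) then (1 : ℝ) else 0 := by simp
        _ = _ := Finset.sum_congr rfl fun x _ => by simp [Set.indicator_apply, hj]
  have hint : ∀ (X : Set ℝ) (c : ℝ), MeasurableSet X →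
      Integrable (X.indicator fun _ => c) (volume.restrict (Set.Ico (a : ℝ) d)) :=
    fun X c hX => (integrable_const c).indicator hX
  have hval : ∀ (X : Set ℝ) (c : ℝ), MeasurableSet X →
      ∫ t in Set.Ico (a : ℝ) d, X.indicator (fun _ => c) t =
        c * volume.real (X ∩ Set.Ico (a : ℝ) d) := by
    intro X c hX
    rw [integral_indicator_const _ hX, measureReal_restrict_apply hX, smul_eq_mul, mul_comm]
  have hm : ∀ i ρ, MeasurableSet (exec (i, ρ) \ exec j₀) := fun i ρ =>
    (hE.measurable _).diff (hE.measurable _)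
  rw [intervalIntegral.integral_of_le had', ← integral_Ico_eq_integral_Ioc]
  have hsint : IntegrableOn (fun t => (s t : ℝ)) (Set.Ico (a : ℝ) d) := by
    rw [integrableOn_Ico_iff_integrableOn_Ioo, ← integrableOn_Ioc_iff_integrableOn_Ioo]
    exact (intervalIntegrable_iff_integrableOn_Ioc_of_le had').1
      (hs.intervalIntegrable (Nat.cast_nonneg a) (Nat.cast_nonneg d))
  refine (setIntegral_mono_on hsint ?_ measurableSet_Ico hpt).trans (le_of_eq ?_)
  · exact (hint _ _ (hE.measurable _)).add (integrable_finsetSum _ fun i _ =>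
      integrable_finsetSum _ fun ρ _ => hint _ _ (hm i ρ))
  · rw [integral_add (hint _ _ (hE.measurable _)) (integrable_finsetSum _ fun i _ =>
      integrable_finsetSum _ fun ρ _ => hint _ _ (hm i ρ)), hval _ _ (hE.measurable _),
      integral_finsetSum _ fun i _ => integrable_finsetSum _ fun ρ _ => hint _ _ (hm i ρ)]
    congr 1
    refine Finset.sum_congr rfl fun i _ => ?_
    rw [integral_finsetSum _ fun ρ _ => hint _ _ (hm i ρ)]
    refine Finset.sum_congr rfl fun ρ _ => ?_
    rw [hval _ _ (hm i ρ), one_mul, interference]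

/-! ### The schedulability test -/

open Classical in
/-- Before each release `r` there is an instant `a` from which all processors are busy with jobs
of deadline at most `d` until `r`, and at which at most `m' - 1` tasks carry in. -/
lemma IsGEDF.exists_busy_start {Γ : MPR} (hs : Γ.IsSupply s) (hE : IsGEDF s J exec) (r d : ℕ) :
    ∃ a ≤ r, (∀ t : ℝ, a ≤ t → t < r →
        (s t : ℕ∞) ≤ {j | t ∈ exec j ∧ deadline τ j ≤ d}.encard) ∧
      (Finset.univ.filter (CarryIn J exec a d)).card ≤ Γ.procs - 1 := by
  let Busy : ℕ → Prop := fun a => ∀ t : ℝ, a ≤ t → t < r →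
    (s t : ℕ∞) ≤ {j | t ∈ exec j ∧ deadline τ j ≤ d}.encard
  have hex : ∃ a, Busy a := ⟨r, fun t h1 h2 => absurd h2 (not_lt.2 h1)⟩
  refine ⟨Nat.find hex, Nat.find_min' hex fun t h1 h2 => absurd h2 (not_lt.2 h1),
    Nat.find_spec hex, ?_⟩
  rcases h : Nat.find hex with _ | a
  · have : Finset.univ.filter (CarryIn J exec 0 d) = ∅ :=
      Finset.filter_eq_empty_iff.2 fun i _ ⟨ρ, hρ, _⟩ => absurd hρ (Nat.not_lt_zero ρ)
    rw [this]
    exact Nat.zero_le _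
  · have hnot := Nat.find_min hex (m := a) (by omega)
    have hspec := Nat.find_spec hex
    rw [h] at hspec
    simp only [Busy, not_forall, not_le] at hnot
    obtain ⟨t, hat, htr, hidle⟩ := hnot
    have ht0 : 0 ≤ t := (Nat.cast_nonneg a).trans hat
    -- By minimality the idle instant belongs to the unit interval just before the busy stretch.
    have hta : t ≤ (a + 1 : ℕ) := by
      by_contra! hlt
      exact absurd (hspec t hlt.le htr) (not_le.2 hidle)
    have h1 := hE.card_carryIn_lt (a := a + 1) ht0 (by push_cast; linarith) hta hidle
    have h2 := hs.2.1 t ht0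
    omega

/-- If each of the interferences `I i` is bounded both by `w i` and by the time during which the
analysed job does not execute, then the supply is below the demand bound, or the demand bound
exceeds what `m` processors can supply. -/
lemma supply_lt_or_le_demand (k : Fin n) (w I : Fin n → ℝ) (m : ℕ) {A t C e S : ℝ} (he : e < C)
    (hCt : C ≤ t) (hnn : ∀ i, 0 ≤ min (w i) (if i = k then A else t - C)) (hIw : ∀ i, I i ≤ w i)
    (hIt : ∀ i, I i ≤ if i = k then A else t - e) (hS : S ≤ m * e + ∑ i, I i) :
    S < m * C + ∑ i, min (w i) (if i = k then A else t - C) ∨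
      m * t ≤ m * C + ∑ i, min (w i) (if i = k then A else t - C) := by
  classical
  -- `B` holds the tasks whose cap binds. Lowering the cap from `t - e` to `t - C` loses at most `C
  -- - e` for each. With fewer than `m` of them, raising `m * e` to `m * C` more than compensates;
  -- with at least `m`, they alone contribute `m * (t - C)`.
  set B := Finset.univ.filter fun i => i ≠ k ∧ t - C < w i with hB
  rcases lt_or_ge B.card m with hlt | hge
  · left
    have h1 : ∀ i, I i ≤ min (w i) (if i = k then A else t - C) + if i ∈ B then C - e else 0 := by
      intro i
      have ha := hIw i
      have hb := hIt i
      by_cases hik : i = k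
      · simp only [hik, if_true] at ha hb ⊢
        have : k ∉ B := by simp [hB]
        rw [if_neg this, add_zero]
        exact le_min ha hb
      · simp only [hik, if_false] at hb ⊢
        by_cases hw : t - C < w i
        · rw [min_eq_right hw.le, if_pos (by simp [hB, hik, hw])]
          linarith
        · rw [min_eq_left (not_lt.1 hw), if_neg (by simp [hB, not_lt.1 hw])]
          linarith
    have h2 := Finset.sum_le_sum fun i (_ : i ∈ Finset.univ) => h1 i
    rw [Finset.sum_add_distrib, Finset.sum_ite_mem, Finset.univ_inter, Finset.sum_const,
      nsmul_eq_mul] at h2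
    have h3 : (B.card : ℝ) < m := by exact_mod_cast hlt
    have h4 := mul_lt_mul_of_pos_right h3 (sub_pos.2 he)
    linarith
  · right
    have h1 : ∑ i ∈ B, (t - C) ≤ ∑ i, min (w i) (if i = k then A else t - C) := by
      refine (Finset.sum_le_sum fun i hi => ?_).trans
        (Finset.sum_le_sum_of_subset_of_nonneg (Finset.subset_univ B) fun i _ _ => hnn i)
      obtain ⟨-, hik, hw⟩ := Finset.mem_filter.1 hi
      rw [if_neg hik, min_eq_right hw.le]
    rw [Finset.sum_const, nsmul_eq_mul] at h1
    have h2 : (m : ℝ) ≤ B.card := by exact_mod_cast hge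
    have h3 := mul_le_mul_of_nonneg_right h2 (sub_nonneg.2 hCt)
    linarith

/-- Work of task `i` that interferes with the job `(k, r)`, with or without carry-in. -/
lemma IsGEDF.sum_interference_le_workload (hE : IsGEDF s J exec) {k : Fin n} {r a d : ℕ}
    (hr : r ∈ J.release k) (hd : d = r + (τ k).D) (har : a ≤ r)
    (hmeet : ∀ i, ∀ r ∈ J.release i, deadline τ (i, r) < d →
      J.cost (i, r) ≤ service exec (i, r) (deadline τ (i, r))) (i : Fin n) :
    (∑ ρ ∈ releasesUpTo J d i, interference exec (k, r) a d (i, ρ) ≤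
        (τ i).W ((d : ℝ) - a) - if i = k then (τ k).C else 0) ∧
      (¬ CarryIn J exec a d i →
        ∑ ρ ∈ releasesUpTo J d i, interference exec (k, r) a d (i, ρ) ≤
          (τ i).count ((d : ℝ) - a) * (τ i).C - if i = k then (τ k).C else 0) := by
  have had : a ≤ d := by omega
  have hsep : ∀ x ∈ releasesUpTo J d i, ∀ y ∈ releasesUpTo J d i, x < y → x + (τ i).T ≤ y :=
    fun x hx y hy => J.separated i x (mem_releasesUpTo.1 hx).1 y (mem_releasesUpTo.1 hy).1
  have hdl : ∀ x ∈ releasesUpTo J d i, x + (τ i).D ≤ d := fun x hx => (mem_releasesUpTo.1 hx).2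
  -- the analysed job is accounted for with its full requirement
  let v : ℕ → ℝ := fun ρ => interference exec (k, r) a d (i, ρ) +
    if i = k ∧ ρ = r then (τ k).C else 0
  have hv0 : ∀ ρ, ¬ (i = k ∧ ρ = r) → v ρ = interference exec (k, r) a d (i, ρ) :=
    fun ρ h => by simp [v, h]
  have hv1 : ∀ ρ, i = k ∧ ρ = r → v ρ = (τ i).C := by
    rintro ρ ⟨rfl, rfl⟩
    simp [v, interference_self]
  have hsum : ∑ ρ ∈ releasesUpTo J d i, v ρ =
      ∑ ρ ∈ releasesUpTo J d i, interference exec (k, r) a d (i, ρ) +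
        if i = k then (τ k).C else 0 := by
    rw [Finset.sum_add_distrib]
    congr 1
    by_cases hik : i = k
    · subst hik
      simp [mem_releasesUpTo, hr, hd]
    · simp [hik]
  have hvC : ∀ x ∈ releasesUpTo J d i, v x ≤ (τ i).C := by
    intro x hx
    by_cases h : i = k ∧ x = r
    · exact (hv1 x h).le
    · rw [hv0 x h]
      exact hE.interference_le_C _ _ _ (mem_releasesUpTo.1 hx).1
  constructor
  · have := (τ i).sum_le_W had (releasesUpTo J d i) hsep hdl v hvC fun x hx => by
      by_cases h : i = k ∧ x = r
      · rw [hv1 x h]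
        refine le_max_of_le_right ?_
        have : (a : ℝ) ≤ x := by rw [h.2]; exact_mod_cast har
        linarith [(τ i).C_le_D]
      · rw [hv0 x h]
        exact hE.interference_le_window _ _ hmeet _ _
    linarith
  · intro hc
    have := (τ i).sum_le_count_mul had (releasesUpTo J d i) hsep hdl v hvC fun x hx hxa => by
      rw [hv0 x (fun h => by omega)]
      exact (hE.interference_eq_zero _ hxa (hdl x hx) hc).le
    linarith

/-- Time during which task `i` can interfere with the job `(k, r)`. -/
lemma IsGEDF.sum_interference_le_length (hE : IsGEDF s J exec) {k : Fin n} {r a d : ℕ}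
    (hd : d = r + (τ k).D) (har : a ≤ r)
    (hmeet : ∀ i, ∀ r ∈ J.release i, deadline τ (i, r) < d →
      J.cost (i, r) ≤ service exec (i, r) (deadline τ (i, r))) (hr : r ∈ J.release k)
    (i : Fin n) :
    ∑ ρ ∈ releasesUpTo J d i, interference exec (k, r) a d (i, ρ) ≤
      if i = k then (r : ℝ) - a else
        (d : ℝ) - a - volume.real (exec (k, r) ∩ Set.Ico (a : ℝ) d) := by
  have had : (a : ℝ) ≤ d := by exact_mod_cast (by omega : a ≤ d)
  have har' : (a : ℝ) ≤ r := by exact_mod_cast har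
  split_ifs with hik
  -- The other jobs of task `k` with deadline at most `d` are released before `r`, and their
  -- deadlines are at most `r`, so they interfere only in `[a, r)`.
  · subst hik
    rw [← Real.volume_real_Ico_of_le har']
    refine hE.sum_interference_le _ hmeet i _ _ (by simp) ?_
    rintro ρ hρ x ⟨⟨hx, hx'⟩, hxa, hxd⟩
    obtain ⟨hρ1, hρ2⟩ := mem_releasesUpTo.1 hρ
    have hne : ρ ≠ r := fun h => hx' (h ▸ hx)
    have hlt : ρ < r := by omega
    have h1 := J.separated i ρ hρ1 r hr hlt
    have h2 := hE.lt_deadline hmeet ((Nat.cast_nonneg a).trans hxa) hxd hx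
    have h3 := (τ i).D_le_T
    have h4 : deadline τ (i, ρ) ≤ r := by simp only [deadline]; omega
    exact ⟨hxa, h2.trans_le (by exact_mod_cast h4)⟩
  · have h1 : volume.real (Set.Ico (a : ℝ) d \ exec (k, r)) =
        (d : ℝ) - a - volume.real (exec (k, r) ∩ Set.Ico (a : ℝ) d) := by
      rw [← Real.volume_real_Ico_of_le had, Set.inter_comm,
        ← measureReal_inter_add_sdiff (s := Set.Ico (a : ℝ) d) (hE.measurable (k, r)) (by simp)]
      ring
    rw [← h1]
    refine hE.sum_interference_le _ hmeet i _ _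
      (measure_ne_top_of_subset Set.sdiff_subset (by simp)) ?_
    rintro ρ - x ⟨⟨_, hx'⟩, hx⟩
    exact ⟨hx, hx'⟩

open Classical in
/-- A first deadline miss contradicts the schedulability test for the missing task. -/
lemma IsGEDF.no_first_miss {Γ : MPR} (hs : Γ.IsSupply s) (hE : IsGEDF s J exec) {k : Fin n}
    {r d : ℕ} (hr : r ∈ J.release k) (hd : d = r + (τ k).D)
    (hmeet : ∀ i, ∀ r ∈ J.release i, deadline τ (i, r) < d →
      J.cost (i, r) ≤ service exec (i, r) (deadline τ (i, r)))
    (hmiss : service exec (k, r) d < J.cost (k, r))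
    (h : ∀ A : ℕ, dem τ Γ.procs k (A : ℝ) ≤ Γ.sbf ((A : ℝ) + ((τ k).D : ℝ))) : False := by
  obtain ⟨a, har, hbusy, hcard⟩ := hE.exists_busy_start hs r d
  set S := Finset.univ.filter (CarryIn J exec a d) with hS
  have had : a ≤ d := by omega
  have had' : (a : ℝ) ≤ d := by exact_mod_cast had
  set e := volume.real (exec (k, r) ∩ Set.Ico (a : ℝ) d) with he
  have heC : e < (τ k).C := by
    have h1 : e ≤ service exec (k, r) d := by
      refine measureReal_mono ?_ (measure_ne_top_of_subset Set.inter_subset_right (by simp))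
      rintro x ⟨hx, hxa, hxd⟩
      exact ⟨hx, (Nat.cast_nonneg a).trans hxa, hxd.le⟩
    exact h1.trans_lt (hmiss.trans_le (J.cost_le k r hr))
  have he0 : 0 ≤ e := measureReal_nonneg
  have hA0 : (0 : ℝ) ≤ (r - a : ℕ) := Nat.cast_nonneg _
  have hAr : ((r - a : ℕ) : ℝ) = r - a := by push_cast [har]; ring
  have hdR : (d : ℝ) = r + (τ k).D := by exact_mod_cast hd
  have ht : ((r - a : ℕ) : ℝ) + (τ k).D = d - a := by rw [hAr, hdR]; ring
  have hCt : (τ k).C ≤ (d : ℝ) - a := by rw [← ht]; linarith [(τ k).C_le_D]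
  -- From `r` to `d` the missing job is pending, so whenever it waits, EDF fills all processors with
  -- deadlines at most `d`.
  have hall : ∀ t : ℝ, a ≤ t → t < d → t ∉ exec (k, r) →
      (s t : ℕ∞) ≤ {j | t ∈ exec j ∧ deadline τ j ≤ d}.encard := by
    intro t hat htd hn
    rcases lt_or_ge t r with htr | hrt
    · exact hbusy t hat htr
    · have hpend : Pending J exec t (k, r) :=
        ⟨hr, hrt, (service_mono exec _ htd.le).trans_lt hmiss⟩
      have ht0 : 0 ≤ t := (Nat.cast_nonneg a).trans hat
      rw [← hE.work_conserving t ht0 ⟨_, hpend, hn⟩]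
      exact Set.encard_le_encard fun j hj =>
        ⟨hj, (hE.edf t ht0 j _ hj hpend hn).trans hd.ge⟩
  have hsup := hs.integral_le hE (k, r) had hall
  have hsbf := hs.sbf_le_integral a (d - a)
  have hda : ((d - a : ℕ) : ℝ) = d - a := by push_cast [had]; ring
  rw [hda, add_sub_cancel] at hsbf
  let w : Fin n → ℝ := fun i =>
    (if i ∈ S then (τ i).W ((d : ℝ) - a) else (τ i).count ((d : ℝ) - a) * (τ i).C) -
      if i = k then (τ k).C else 0
  have hw : ∀ i, (if i ∈ S then Ibar τ k (r - a : ℕ) i else Ihat τ k (r - a : ℕ) i) =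
      min (w i) (if i = k then ((r - a : ℕ) : ℝ) else (d : ℝ) - a - (τ k).C) := by
    intro i
    unfold Ibar Ihat
    simp only [ht, w]
    by_cases hik : i = k
    · subst hik
      simp only [if_true, SporadicTask.W]
      split_ifs
      · rfl
      · congr 1; ring
    · simp only [hik, if_false, SporadicTask.W, sub_zero]
      split_ifs
      · rfl
      · congr 1; ring
  have hdem := le_dem τ Γ.procs k (r - a : ℕ) S hcard
  have htest := h (r - a)
  rw [ht] at htest
  have hnn : ∀ i, 0 ≤ min (w i) (if i = k then ((r - a : ℕ) : ℝ) else (d : ℝ) - a - (τ k).C) := by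
    intro i
    rw [← hw i]
    have h1 := Ihat_nonneg τ k hA0 i
    split_ifs
    · exact h1.trans (Ihat_le_Ibar τ k _ i)
    · exact h1
  simp only [hw] at hdem
  -- The window has positive length because `0 ≤ e < C_k ≤ d - a`.
  have hlt := Γ.sbf_lt (t := (d : ℝ) - a) (by linarith)
  have hIw : ∀ i, ∑ ρ ∈ releasesUpTo J d i, interference exec (k, r) a d (i, ρ) ≤ w i := by
    intro i
    obtain ⟨h1, h2⟩ := hE.sum_interference_le_workload hr hd har hmeet i
    simp only [w]
    by_cases hi : i ∈ S
    · rw [if_pos hi]; exact h1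
    · rw [if_neg hi]
      exact h2 fun hc => hi (Finset.mem_filter.2 ⟨Finset.mem_univ _, hc⟩)
  have hIt : ∀ i, ∑ ρ ∈ releasesUpTo J d i, interference exec (k, r) a d (i, ρ) ≤
      if i = k then ((r - a : ℕ) : ℝ) else (d : ℝ) - a - e := by
    intro i
    rw [hAr]
    exact hE.sum_interference_le_length hd har hmeet hr i
  rcases supply_lt_or_le_demand k w _ Γ.procs heC hCt hnn hIw hIt hsup with h1 | h1 <;> linarith

end Schedule

end ClusterSched

theorem mainTheorem2 {n : ℕ} (τ : Fin n → ClusterSched.SporadicTask) (Γ : ClusterSched.MPR)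
    (h : ∀ (k : Fin n) (A : ℕ),
      ClusterSched.dem τ Γ.procs k (A : ℝ) ≤ Γ.sbf ((A : ℝ) + ((τ k).D : ℝ))) :
    ClusterSched.Schedulable τ Γ := by
  classical
  intro s hs J exec hE i r hr
  by_contra! hmiss
  have hex : ∃ d : ℕ, ∃ i, ∃ r ∈ J.release i, ClusterSched.deadline τ (i, r) = d ∧
      ClusterSched.service exec (i, r) d < J.cost (i, r) := ⟨_, i, r, hr, rfl, hmiss⟩
  -- Choosing the least missed deadline ensures that all strictly earlier deadlines are met.
  obtain ⟨k, r', hr', hd, hmiss'⟩ := Nat.find_spec hex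
  refine hE.no_first_miss hs hr' hd.symm (fun i ρ hρ hlt => ?_) hmiss' (h k)
  by_contra! hm
  exact Nat.find_min hex hlt ⟨i, ρ, hρ, rfl, hm⟩
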